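/- Let $\mathbb K$ be a field and let $\mathbb K\langle x,y\rangle$ be the free associative algebra on two generators. A homogeneous potential of degree $d$ is an element $F\in\mathbb K\langle x,y\rangle$ that is homogeneous of degree $d$ and cyclically invariant (its coefficients are unchanged under cyclic rotation of words). Let $\partial_x,\partial_y$ be the linear maps on $\mathbb K\langle x,y\rangle$ given on words by $\partial_x(xu)=u$, $\partial_x(w)=0$ if $w$ does not start with $x$, and $\partial_y(yu)=u$, $\partial_y(w)=0$ if $w$ does not start with $y$. The potential algebra of $F$ is $A_F=\mathbb K\langle x,y\rangle/(\partial_xF,\partial_yF)$, the quotient by the two-sided ideal generated by $\partial_xF$ and $\partial_yF$. Let $a_F(k)$ be the dimension of the degree-$k$ component of $A_F$ (the span in $A_F$ of the words of length $k$), and let $g_F(k)$ be the dimension of the span in $A_F$ of the words of length at most $k$ (the growth function). Then: 1. There is a homogeneous potential $F$ of degree $4$ such that $A_F$ has polynomial growth: there are $C\in\mathbb R$ and $d\in\mathbb N$ with $g_F(k)\le C(k+1)^d$ for all $k\ge 0$. 2. For every homogeneous potential $F$ of degree $4$ the growth of $A_F$ is at least quadratic and never linear: there is $c>0$ with $a_F(k)\ge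 c\,k^2$ for all $k\ge0$, hence also $g_F(k)\ge c\,k^2$ for all $k\ge0$, and neither $a_F(k)$ nor $g_F(k)$ is bounded above by $C(k+1)$ for any constant $C$. 3. For every $n\ge 5$ and every homogeneous potential $F$ of degree $n$ the growth of $A_F$ is exponential: there are real numbers $c>0$, $r>1$, $C$, $R$ with $c\,r^k\le g_F(k)\le C R^k$ for all $k\ge0$. -/

import Mathlib

namespace PotentialAlgebra

/-- The monomial `w` (a word in the letters `x = 0` and `y = 1`) as an element of the free
associative algebra `K⟨x, y⟩`. -/
noncomputable def monomial (K : Type*) [Field K] (w : FreeMonoid (Fin 2)) :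
    FreeAlgebra K (Fin 2) :=
  FreeAlgebra.basisFreeMonoid K (Fin 2) w

/-- The coefficient of the monomial `w` in `F`. -/
noncomputable def coeff {K : Type*} [Field K] (F : FreeAlgebra K (Fin 2))
    (w : FreeMonoid (Fin 2)) : K :=
  (FreeAlgebra.basisFreeMonoid K (Fin 2)).repr F w

/-- `F` is cyclically invariant: its coefficients do not change under cyclic rotation of words. -/
def IsCyclicallyInvariant {K : Type*} [Field K] (F : FreeAlgebra K (Fin 2)) : Prop :=
  ∀ u v : FreeMonoid (Fin 2), coeff F (u * v) = coeff F (v * u)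

/-- The homogeneous component of degree `k` of `K⟨x, y⟩`. -/
noncomputable def homogeneousPart (K : Type*) [Field K] (k : ℕ) :
    Submodule K (FreeAlgebra K (Fin 2)) :=
  Submodule.span K (monomial K '' {w | w.length = k})

/-- The elements of degree at most `k` of `K⟨x, y⟩`. -/
noncomputable def filteredPart (K : Type*) [Field K] (k : ℕ) :
    Submodule K (FreeAlgebra K (Fin 2)) :=
  Submodule.span K (monomial K '' {w | w.length ≤ k})

/-- The derivative of a monomial with respect to the letter `i`: the monomial `u` if the word
is `i u`, and `0` if the word does not start with `i`. -/
noncomputable def wordDeriv (K : Type*) [Field K] (i : Fin 2) :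
    List (Fin 2) → FreeAlgebra K (Fin 2)
  | [] => 0
  | j :: u => if j = i then monomial K (FreeMonoid.ofList u) else 0

/-- The noncommutative partial derivative, a linear endomorphism of `K⟨x, y⟩`. -/
noncomputable def pderiv (K : Type*) [Field K] (i : Fin 2) :
    FreeAlgebra K (Fin 2) →ₗ[K] FreeAlgebra K (Fin 2) :=
  (FreeAlgebra.basisFreeMonoid K (Fin 2)).constr K fun w => wordDeriv K i w.toList

/-- `F` is a homogeneous potential of degree `d`. -/
def IsHomogeneousPotential {K : Type*} [Field K] (d : ℕ) (F : FreeAlgebra K (Fin 2)) : Prop :=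
  F ∈ homogeneousPart K d ∧ IsCyclicallyInvariant F

/-- The defining relations `∂F/∂x = 0` and `∂F/∂y = 0`. -/
inductive Rel {K : Type*} [Field K] (F : FreeAlgebra K (Fin 2)) :
    FreeAlgebra K (Fin 2) → FreeAlgebra K (Fin 2) → Prop
  | of (i : Fin 2) : Rel F (pderiv K i F) 0

/-- The potential algebra `A_F`, the quotient of `K⟨x, y⟩` by the two-sided ideal generated by
`∂F/∂x` and `∂F/∂y`. -/
abbrev PotAlg {K : Type*} [Field K] (F : FreeAlgebra K (Fin 2)) : Type _ :=
  RingQuot (Rel F)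

/-- The quotient map `K⟨x, y⟩ → A_F`. -/
noncomputable def toPotAlg {K : Type*} [Field K] (F : FreeAlgebra K (Fin 2)) :
    FreeAlgebra K (Fin 2) →ₐ[K] PotAlg F :=
  RingQuot.mkAlgHom K (Rel F)

/-- The Hilbert function of `A_F`: the dimension of its degree `k` component, i.e. of the span in
`A_F` of all words of length `k`. -/
noncomputable def hilbertFn {K : Type*} [Field K] (F : FreeAlgebra K (Fin 2)) (k : ℕ) : ℕ :=
  Module.finrank K ((homogeneousPart K k).map (toPotAlg F).toLinearMap)

/-- The growth function of `A_F` for the generators `x, y`: the dimension of the span in `A_F` of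
all words of length at most `k`. -/
noncomputable def growthFn {K : Type*} [Field K] (F : FreeAlgebra K (Fin 2)) (k : ℕ) : ℕ :=
  Module.finrank K ((filteredPart K k).map (toPotAlg F).toLinearMap)

/-- `f` is bounded above by a polynomial. -/
def IsPolynomiallyBounded (f : ℕ → ℕ) : Prop :=
  ∃ (C : ℝ) (d : ℕ), ∀ k, (f k : ℝ) ≤ C * ((k : ℝ) + 1) ^ d

/-- `f` is bounded above by a linear function. -/
def IsLinearlyBounded (f : ℕ → ℕ) : Prop :=
  ∃ C : ℝ, ∀ k, (f k : ℝ) ≤ C * ((k : ℝ) + 1)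

/-- `f` grows at least quadratically. -/
def IsAtLeastQuadratic (f : ℕ → ℕ) : Prop :=
  ∃ c : ℝ, 0 < c ∧ ∀ k : ℕ, c * (k : ℝ) ^ 2 ≤ f k

/-- `f` grows exponentially: it lies between two exponential functions with bases `> 1`. -/
def IsExponential (f : ℕ → ℕ) : Prop :=
  ∃ c r C R : ℝ, 0 < c ∧ 1 < r ∧ ∀ k : ℕ, c * r ^ k ≤ f k ∧ (f k : ℝ) ≤ C * R ^ k

end PotentialAlgebra

namespace PotentialAlgebra

open Finsupp Submodule

/-! Write the degree of the potential as `r + 4`, so that both relations have degree `l = r + 3`,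
and let `I` be the ideal they generate. The heart of the proof is a lower bound valid for every
potential: the dimension of `A_F` in degree `k` is at least the number of words of length `k`
avoiding `y^(r+2) x` and `y^(r+1) x x` (`card_normalWords_le_hilbertFn`).

Let `V` be the span of the letters. Modulo `I_k V`, the space `I_(k+1)` is spanned by products `u
r_i` with `u` in a spanning set of `A_m`, where `m = k + 1 - l`. Cyclic invariance gives the syzygy
`x r_x + y r_y = r_x x + r_y y`, so `u r_y` is redundant when `u` ends in `y`. If the normal words
span every `A_m`, the resulting upper bound on `dim I_(k+1)` matches the recursion
`card_normalWords_succ` for normal words, and induction gives `dim I_k + #normal ≤ 2^k`.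

Normal words need not span for a given `F`. They do for the sum of all words with exactly two `x`,
whose derivatives have the two forbidden words as leading terms (`wordSpan_le_model`). Join `F` (at
`t = 0`) to this model (at `t = 1`) by a line and work over `K(t)`. Spanning at `t = 1` gives
spanning over `K(t)`, hence the bound there; the dimension of the ideal can only drop on
specializing to `t = 0`, so the bound holds for `F`.

It remains to count. In degree 4 the normal words are `x^i (yx)^j y^l`, quadratically many of each
length; the model attains this count as an upper bound, so its growth is at most cubic. In degree at
least 5 every word without `yy` is normal, and there are exponentially many of these. -/

/-! ### Words of a given length -/

/-- The words of length `k`. -/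
noncomputable def words (k : ℕ) : Finset (List (Fin 2)) :=
  (List.finite_length_eq (Fin 2) k).toFinset

@[simp] lemma mem_words {k : ℕ} {w : List (Fin 2)} : w ∈ words k ↔ w.length = k := by
  simp [words]

lemma sum_words_cons {M : Type*} [AddCommMonoid M] (k : ℕ) (g : List (Fin 2) → M) :
    ∑ w ∈ words (k + 1), g w = ∑ a : Fin 2, ∑ w ∈ words k, g (a :: w) := by
  rw [← Finset.sum_product']
  symm
  refine Finset.sum_bij (fun p _ => p.1 :: p.2) ?_ ?_ ?_ ?_
  · rintro ⟨a, w⟩ h; simpa using h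
  · rintro ⟨a, w⟩ _ ⟨b, v⟩ _ h; simpa using h
  · rintro (_ | ⟨a, w⟩) h
    · simp at h
    · exact ⟨(a, w), by simpa using h, rfl⟩
  · intros; rfl

lemma sum_words_concat {M : Type*} [AddCommMonoid M] (k : ℕ) (g : List (Fin 2) → M) :
    ∑ w ∈ words (k + 1), g w = ∑ a : Fin 2, ∑ w ∈ words k, g (w ++ [a]) := by
  rw [← Finset.sum_product']
  symm
  refine Finset.sum_bij (fun p _ => p.2 ++ [p.1]) ?_ ?_ ?_ ?_
  · rintro ⟨a, w⟩ h; simpa using h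
  · rintro ⟨a, w⟩ _ ⟨b, v⟩ _ h
    have := List.append_inj' h rfl
    simp_all
  · intro w h
    rcases List.eq_nil_or_concat w with rfl | ⟨v, a, rfl⟩
    · simp at h
    · exact ⟨(a, v), by simpa using h, by simp⟩
  · intros; rfl

lemma card_words (k : ℕ) : (words k).card = 2 ^ k := by
  induction k with
  | zero =>
    have : words 0 = {[]} := by ext w; simp
    simp [this]
  | succ k ih =>
    rw [Finset.card_eq_sum_ones, sum_words_cons]
    simp [ih, pow_succ, mul_comm]

/-! ### The graded pieces of the ideal generated by the cyclic derivatives -/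

section Core

variable {R : Type*} [CommRing R]

/-- The element `u · r i · v` of the free algebra, where `r i` is the homogeneous relation of
degree `l` with coefficients `w ↦ c (i :: w)`. -/
noncomputable def relElt (l : ℕ) (c : List (Fin 2) → R) (i : Fin 2) (u v : List (Fin 2)) :
    List (Fin 2) →₀ R :=
  ∑ w ∈ words l, single (u ++ w ++ v) (c (i :: w))

/-- The index set of the spanning family of the degree `k` part of the ideal. -/
abbrev RelIdx (l k : ℕ) : Type :=
  {p : Fin 2 × List (Fin 2) × List (Fin 2) // p.2.1.length + p.2.2.length + l = k}

/-- The spanning family of the degree `k` part of the ideal. -/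
noncomputable def relFam (l : ℕ) (c : List (Fin 2) → R) (k : ℕ) (p : RelIdx l k) :
    List (Fin 2) →₀ R :=
  relElt l c p.1.1 p.1.2.1 p.1.2.2

/-- The degree `k` part of the ideal generated by the relations. -/
noncomputable def relSpan (l : ℕ) (c : List (Fin 2) → R) (k : ℕ) :
    Submodule R (List (Fin 2) →₀ R) :=
  span R (Set.range (relFam l c k))

/-- The span of a set of words. -/
noncomputable def wordSpan (R : Type*) [CommRing R] (S : Set (List (Fin 2))) :
    Submodule R (List (Fin 2) →₀ R) :=
  span R ((fun w => single w (1 : R)) '' S)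

lemma single_mem_wordSpan {S : Set (List (Fin 2))} {w : List (Fin 2)} (hw : w ∈ S) (a : R) :
    single w a ∈ wordSpan R S := by
  have : single w a = a • single w (1 : R) := by simp
  rw [this]
  exact smul_mem _ _ (subset_span ⟨w, hw, rfl⟩)

lemma relElt_mem {l : ℕ} (c : List (Fin 2) → R) (i : Fin 2) {u v : List (Fin 2)} {k : ℕ}
    (h : u.length + v.length + l = k) : relElt l c i u v ∈ relSpan l c k :=
  subset_span ⟨⟨(i, u, v), h⟩, rfl⟩

lemma relSpan_le {l : ℕ} {c : List (Fin 2) → R} {k : ℕ} {M : Submodule R (List (Fin 2) →₀ R)}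
    (h : ∀ i u v, u.length + v.length + l = k → relElt l c i u v ∈ M) : relSpan l c k ≤ M := by
  rw [relSpan, span_le]
  rintro _ ⟨⟨⟨i, u, v⟩, hp⟩, rfl⟩
  exact h i u v hp

lemma relSpan_le_wordSpan (l : ℕ) (c : List (Fin 2) → R) (k : ℕ) :
    relSpan l c k ≤ wordSpan R (words k) := by
  refine relSpan_le fun i u v h => sum_mem fun w hw => single_mem_wordSpan ?_ _
  simp only [mem_words] at hw
  simp only [Finset.mem_coe, mem_words, List.length_append]
  omega

/-- Right multiplication by the letter `a`. -/
noncomputable def mulLetter (R : Type*) [CommRing R] (a : Fin 2) :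
    (List (Fin 2) →₀ R) →ₗ[R] (List (Fin 2) →₀ R) :=
  lmapDomain R R fun w => w ++ [a]

lemma mulLetter_relElt (l : ℕ) (c : List (Fin 2) → R) (i : Fin 2) (u v : List (Fin 2))
    (a : Fin 2) : mulLetter R a (relElt l c i u v) = relElt l c i u (v ++ [a]) := by
  simp [mulLetter, relElt, mapDomain_single]

/-- Right multiplication by the relation `r i`. -/
noncomputable def mulRel (l : ℕ) (c : List (Fin 2) → R) (i : Fin 2) :
    (List (Fin 2) →₀ R) →ₗ[R] (List (Fin 2) →₀ R) :=
  Finsupp.linearCombination R fun u => relElt l c i u []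

@[simp] lemma mulRel_single (l : ℕ) (c : List (Fin 2) → R) (i : Fin 2) (u : List (Fin 2)) (a : R) :
    mulRel l c i (single u a) = a • relElt l c i u [] := by
  simp [mulRel]

/-- In a product of two relations the right-hand one is expanded into words, leaving multiples of
the left-hand one. -/
lemma mulRel_relElt (l : ℕ) (c : List (Fin 2) → R) (i j : Fin 2) (u v : List (Fin 2)) :
    mulRel l c i (relElt l c j u v) = ∑ w ∈ words l, c (i :: w) • relElt l c j u (v ++ w) := by
  rw [relElt, map_sum]
  simp only [mulRel_single, relElt, Finset.smul_sum, smul_single, smul_eq_mul]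
  rw [Finset.sum_comm]
  refine Finset.sum_congr rfl fun w _ => Finset.sum_congr rfl fun w' _ => ?_
  simp [mul_comm]

/-- The part `I_k · V` of the degree `k + 1` component of the ideal. -/
noncomputable def relShift (l : ℕ) (c : List (Fin 2) → R) (k : ℕ) :
    Submodule R (List (Fin 2) →₀ R) :=
  (relSpan l c k).map (mulLetter R 0) ⊔ (relSpan l c k).map (mulLetter R 1)

lemma mulLetter_mem_relShift {l : ℕ} {c : List (Fin 2) → R} {k : ℕ} {e : List (Fin 2) →₀ R}
    (he : e ∈ relSpan l c k) (a : Fin 2) : mulLetter R a e ∈ relShift l c k := by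
  fin_cases a
  · exact mem_sup_left (mem_map_of_mem he)
  · exact mem_sup_right (mem_map_of_mem he)

lemma relElt_mem_relShift {l : ℕ} (c : List (Fin 2) → R) (i : Fin 2) {u v : List (Fin 2)} {k : ℕ}
    (h : u.length + v.length + l = k + 1) (hv : v ≠ []) : relElt l c i u v ∈ relShift l c k := by
  rcases List.eq_nil_or_concat v with rfl | ⟨v, a, rfl⟩
  · exact absurd rfl hv
  · rw [List.concat_eq_append, ← mulLetter_relElt]
    refine mulLetter_mem_relShift (relElt_mem c i ?_) a
    simp at h
    omega

/-- Since `r_i` has positive degree, each word of its expansion supplies a last letter to split off.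
Thus only `u` modulo the ideal matters in `u r_i`. -/
lemma mulRel_mem_relShift {l m k : ℕ} (hl : 1 ≤ l) (hm : m + l = k + 1) (c : List (Fin 2) → R)
    (i : Fin 2) {e : List (Fin 2) →₀ R} (he : e ∈ relSpan l c m) :
    mulRel l c i e ∈ relShift l c k := by
  have : relSpan l c m ≤ (relShift l c k).comap (mulRel l c i) := by
    refine relSpan_le fun j u v h => ?_
    rw [mem_comap, mulRel_relElt]
    refine sum_mem fun w hw => smul_mem _ _ (relElt_mem_relShift c j ?_ ?_)
    · simp only [mem_words] at hw
      simp only [List.length_append]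
      omega
    · rw [mem_words] at hw
      rintro h0
      rw [(List.append_eq_nil_iff.1 h0).2, List.length_nil] at hw
      omega
  exact this he

/-- The syzygy `b x r_x + b y r_y = b r_x x + b r_y y` given by cyclic invariance. -/
lemma sum_relElt_concat {l : ℕ} {c : List (Fin 2) → R}
    (hc : ∀ (a : Fin 2) (w : List (Fin 2)), c (a :: w) = c (w ++ [a])) (b : List (Fin 2)) :
    ∑ a : Fin 2, relElt l c a (b ++ [a]) [] = ∑ a : Fin 2, relElt l c a b [a] := by
  have h1 := sum_words_cons l fun w => single (b ++ w) (c w)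
  have h2 := sum_words_concat l fun w => single (b ++ w) (c w)
  rw [h1] at h2
  simpa [relElt, hc] using h2

lemma relSpan_succ_le {l m k : ℕ} (hl : 1 ≤ l) (hm : m + l = k + 1) {c : List (Fin 2) → R}
    (hc : ∀ (a : Fin 2) (w : List (Fin 2)), c (a :: w) = c (w ++ [a]))
    (S : Finset (List (Fin 2))) (hSm : ∀ u ∈ S, u.length = m)
    (hS : wordSpan R (words m) ≤ relSpan l c m ⊔ wordSpan R S) :
    relSpan l c (k + 1) ≤ relShift l c k ⊔
      (span R ((fun u => relElt l c 0 u []) '' (S : Set (List (Fin 2)))) ⊔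
        span R ((fun u => relElt l c 1 u []) ''
          ((S.filter fun u => ¬ [1] <:+ u : Finset (List (Fin 2))) : Set (List (Fin 2))))) := by
  set X := span R ((fun u => relElt l c 0 u []) '' (S : Set (List (Fin 2)))) with hX
  set Y := span R ((fun u => relElt l c 1 u []) ''
    ((S.filter fun u => ¬ [1] <:+ u : Finset (List (Fin 2))) : Set (List (Fin 2)))) with hY
  -- A general prefix `u` is reduced to prefixes in `S`; the discrepancy lies in `I_m` and is
  -- absorbed by `relShift`.
  have key : ∀ (i : Fin 2) (M : Submodule R (List (Fin 2) →₀ R)), relShift l c k ≤ M →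
      (∀ u ∈ S, relElt l c i u [] ∈ M) → ∀ u : List (Fin 2), u.length = m →
      relElt l c i u [] ∈ M := by
    intro i M hM hSM u hu
    have h1 : single u (1 : R) ∈ relSpan l c m ⊔ wordSpan R S :=
      hS (single_mem_wordSpan (by simpa using hu) 1)
    have h2 : relSpan l c m ⊔ wordSpan R S ≤ M.comap (mulRel l c i) := by
      refine sup_le (fun e he => hM (mulRel_mem_relShift hl hm c i he)) ?_
      rw [wordSpan, span_le]
      rintro _ ⟨w, hw, rfl⟩
      simpa using hSM w hw
    simpa using h2 h1
  have h0 : ∀ u : List (Fin 2), u.length = m → relElt l c 0 u [] ∈ relShift l c k ⊔ X :=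
    key 0 _ le_sup_left fun u hu => mem_sup_right (subset_span ⟨u, hu, rfl⟩)
  have h0' : ∀ u : List (Fin 2), u.length = m →
      relElt l c 0 u [] ∈ relShift l c k ⊔ (X ⊔ Y) := fun u hu =>
    (sup_le_sup_left le_sup_left _ : relShift l c k ⊔ X ≤ _) (h0 u hu)
  have h1 : ∀ u : List (Fin 2), u.length = m →
      relElt l c 1 u [] ∈ relShift l c k ⊔ (X ⊔ Y) := by
    refine key 1 _ le_sup_left fun u hu => ?_
    by_cases hend : [1] <:+ u
    · obtain ⟨b, rfl⟩ := hend
      have hlen := hSm _ hu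
      simp only [List.length_append, List.length_cons, List.length_nil] at hlen
      -- The syzygy rewrites `b y r_y` as `b r_x x + b r_y y - b x r_x`, and `b x r_x` is already
      -- covered by `h0'`.
      have hs := sum_relElt_concat (l := l) hc b
      rw [Fin.sum_univ_two] at hs
      rw [← eq_sub_iff_add_eq'] at hs
      rw [hs]
      refine sub_mem (sum_mem fun a _ => mem_sup_left (relElt_mem_relShift c a ?_ (by simp)))
        (h0' _ (by simpa using hlen))
      simp
      omega
    · exact mem_sup_right (mem_sup_right (subset_span ⟨u, by simpa [hend] using hu, rfl⟩))
  refine relSpan_le fun i u v h => ?_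
  by_cases hv : v = []
  · subst hv
    have hu : u.length = m := by simp at h; omega
    fin_cases i
    · exact h0' u hu
    · exact h1 u hu
  · exact mem_sup_left (relElt_mem_relShift c i h hv)

end Core

/-! ### The dimension recursion for the ideal -/

section Field

variable {L : Type*} [Field L]

instance (S : Finset (List (Fin 2))) : FiniteDimensional L (wordSpan L (S : Set (List (Fin 2)))) :=
  FiniteDimensional.span_of_finite L (S.finite_toSet.image _)

instance (l : ℕ) (c : List (Fin 2) → L) (k : ℕ) : FiniteDimensional L (relSpan l c k) :=
  Submodule.finiteDimensional_of_le (relSpan_le_wordSpan l c k)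

lemma finrank_span_image_le {V ι : Type*} [AddCommGroup V] [Module L V] (g : ι → V)
    (S : Finset ι) : Module.finrank L (span L (g '' (S : Set ι))) ≤ S.card := by
  classical
  rw [← Finset.coe_image]
  exact (finrank_span_finset_le_card _).trans Finset.card_image_le

lemma finrank_wordSpan (S : Finset (List (Fin 2))) :
    Module.finrank L (wordSpan L (S : Set (List (Fin 2)))) = S.card := by
  classical
  have h := (Finsupp.basisSingleOne (R := L) (ι := List (Fin 2))).linearIndependent
  have h2 := h.comp (fun s : S => (s : List (Fin 2))) Subtype.val_injective
  have := finrank_span_eq_card h2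
  rw [Fintype.card_coe] at this
  have hr : (fun w => single w (1 : L)) '' (S : Set (List (Fin 2))) =
      Set.range (Finsupp.basisSingleOne (R := L) ∘ fun s : S => (s : List (Fin 2))) := by
    ext e
    simp
  rw [← this, wordSpan, hr]

lemma finrank_relSpan_succ_le {l m k : ℕ} (hl : 1 ≤ l) (hm : m + l = k + 1)
    {c : List (Fin 2) → L} (hc : ∀ (a : Fin 2) (w : List (Fin 2)), c (a :: w) = c (w ++ [a]))
    (S : Finset (List (Fin 2))) (hSm : ∀ u ∈ S, u.length = m)
    (hS : wordSpan L (words m) ≤ relSpan l c m ⊔ wordSpan L S) :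
    Module.finrank L (relSpan l c (k + 1)) ≤
      2 * Module.finrank L (relSpan l c k) + (S.card + (S.filter fun u => ¬ [1] <:+ u).card) := by
  have h := relSpan_succ_le hl hm hc S hSm hS
  have i1 : FiniteDimensional L (span L ((fun u => relElt l c 0 u []) ''
      (S : Set (List (Fin 2))))) :=
    FiniteDimensional.span_of_finite L (S.finite_toSet.image _)
  have i2 : FiniteDimensional L (span L ((fun u => relElt l c 1 u []) ''
      ((S.filter fun u => ¬ [1] <:+ u : Finset (List (Fin 2))) : Set (List (Fin 2))))) :=
    FiniteDimensional.span_of_finite L ((Finset.finite_toSet _).image _)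
  have i3 : FiniteDimensional L (relShift l c k) := by unfold relShift; infer_instance
  refine (Submodule.finrank_mono h).trans
    ((Submodule.finrank_add_le_finrank_add_finrank _ _).trans (add_le_add ?_ ?_))
  · rw [two_mul]
    exact (Submodule.finrank_add_le_finrank_add_finrank _ _).trans
      (add_le_add (Submodule.finrank_map_le _ _) (Submodule.finrank_map_le _ _))
  · exact (Submodule.finrank_add_le_finrank_add_finrank _ _).trans
      (add_le_add (finrank_span_image_le _ _) (finrank_span_image_le _ _))

end Field


/-! ### Normal words -/

/-- The leading word `y ^ (r + 2) x`. -/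
def leadX (r : ℕ) : List (Fin 2) := List.replicate (r + 2) 1 ++ [0]

/-- The leading word `y ^ (r + 1) x x`. -/
def leadY (r : ℕ) : List (Fin 2) := List.replicate (r + 1) 1 ++ [0, 0]

/-- A word is normal if it contains neither `y ^ (r + 2) x` nor `y ^ (r + 1) x x`. -/
def Normal (r : ℕ) (w : List (Fin 2)) : Prop := ¬ leadX r <:+: w ∧ ¬ leadY r <:+: w

open Classical in
/-- The normal words of length `k`. -/
noncomputable def normalWords (r k : ℕ) : Finset (List (Fin 2)) := (words k).filter (Normal r)

@[simp] lemma mem_normalWords {r k : ℕ} {w : List (Fin 2)} :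
    w ∈ normalWords r k ↔ w.length = k ∧ Normal r w := by
  simp [normalWords]

lemma Normal.of_infix {r : ℕ} {v w : List (Fin 2)} (hw : Normal r w) (h : v <:+: w) :
    Normal r v :=
  ⟨fun h1 => hw.1 (h1.trans h), fun h1 => hw.2 (h1.trans h)⟩

lemma leadX_eq (r : ℕ) : leadX r = List.replicate (r + 2) 1 ++ [0] := rfl

lemma leadY_eq (r : ℕ) : leadY r = (List.replicate (r + 1) 1 ++ [0]) ++ [0] := by simp [leadY]

lemma concat_suffix_concat {α : Type*} {u w : List α} {a b : α} :
    u ++ [a] <:+ w ++ [b] ↔ u <:+ w ∧ a = b := by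
  rw [← List.reverse_prefix]
  simp [and_comm]

lemma Normal.concat_one {r : ℕ} {w : List (Fin 2)} (hw : Normal r w) : Normal r (w ++ [1]) := by
  refine ⟨fun h => ?_, fun h => ?_⟩
  · rcases List.infix_concat_iff.1 h with h | h
    · rw [leadX_eq, concat_suffix_concat] at h
      exact absurd h.2 (by decide)
    · exact hw.1 h
  · rcases List.infix_concat_iff.1 h with h | h
    · rw [leadY_eq, concat_suffix_concat] at h
      exact absurd h.2 (by decide)
    · exact hw.2 h

lemma Normal.append_replicate {r : ℕ} {w : List (Fin 2)} (hw : Normal r w) (j : ℕ) :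
    Normal r (w ++ List.replicate j 1) := by
  induction j with
  | zero => simpa using hw
  | succ j ih =>
    rw [List.replicate_succ', ← List.append_assoc]
    exact ih.concat_one

lemma replicate_suffix_append {α : Type*} {a : α} {w : List α} {i j : ℕ}
    (h : List.replicate (j + i) a <:+ w ++ List.replicate j a) : List.replicate i a <:+ w := by
  induction j with
  | zero => simpa using h
  | succ j ih =>
    rw [show j + 1 + i = (j + i) + 1 by ring, List.replicate_succ', List.replicate_succ',
      ← List.append_assoc, concat_suffix_concat] at h
    exact ih h.1

/-- If `w` ended in `y`, the new tail would contain `y^(r+2) x`. This is the combinatorial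
counterpart of the syzygy restriction on prefixes of `r_y`. -/
lemma Normal.append_replicate_zero {r : ℕ} {w : List (Fin 2)} (hw : Normal r w)
    (h1 : ¬ [1] <:+ w) : Normal r (w ++ List.replicate (r + 1) 1 ++ [0]) := by
  have h0 := hw.append_replicate (r + 1)
  refine ⟨fun h => ?_, fun h => ?_⟩
  · rcases List.infix_concat_iff.1 h with h | h
    · rw [leadX_eq, concat_suffix_concat] at h
      exact h1 (replicate_suffix_append (i := 1) (j := r + 1) h.1)
    · exact h0.1 h
  · rcases List.infix_concat_iff.1 h with h | h
    · rw [leadY_eq, concat_suffix_concat, List.replicate_succ' (n := r), ← List.append_assoc,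
        concat_suffix_concat] at h
      exact absurd h.1.2 (by decide)
    · exact h0.2 h

/-- Three disjoint families of words of length `k + 1` become normal once the last letter is
removed: normal words, `u · leadX r` with `u` normal, and `u · leadY r` with `u` normal not ending
in `y`. All of them lie among the one-letter extensions of normal words of length `k`. -/
lemma card_normalWords_succ {r m k : ℕ} (hm : m + (r + 3) = k + 1) :
    (normalWords r (k + 1)).card +
        ((normalWords r m).card + ((normalWords r m).filter fun u => ¬ [1] <:+ u).card) ≤
      2 * (normalWords r k).card := by
  classical
  set A := normalWords r (k + 1)
  set B := (normalWords r m).image fun w => w ++ leadX r with hB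
  set C := ((normalWords r m).filter fun u => ¬ [1] <:+ u).image fun w => w ++ leadY r with hC
  have cB : B.card = (normalWords r m).card :=
    Finset.card_image_of_injective _ fun _ _ h => List.append_cancel_right h
  have cC : C.card = ((normalWords r m).filter fun u => ¬ [1] <:+ u).card :=
    Finset.card_image_of_injective _ fun _ _ h => List.append_cancel_right h
  have dBC : Disjoint B C := by
    rw [Finset.disjoint_left]
    intro w h1 h2
    obtain ⟨u, -, rfl⟩ := Finset.mem_image.1 h1
    obtain ⟨v, -, h⟩ := Finset.mem_image.1 h2
    rw [leadX_eq, leadY_eq, List.replicate_succ' (n := r + 1)] at h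
    simp only [← List.append_assoc] at h
    have := List.append_inj_left' h rfl
    have := List.append_inj_right' this rfl
    simp at this
  have dA : Disjoint A (B ∪ C) := by
    rw [Finset.disjoint_left]
    intro w h1 h2
    have hn := (mem_normalWords.1 h1).2
    rcases Finset.mem_union.1 h2 with h2 | h2
    · obtain ⟨u, -, rfl⟩ := Finset.mem_image.1 h2
      exact hn.1 (List.suffix_append _ _).isInfix
    · obtain ⟨u, -, rfl⟩ := Finset.mem_image.1 h2
      exact hn.2 (List.suffix_append _ _).isInfix
  have hsub : A ∪ (B ∪ C) ⊆ (normalWords r k ×ˢ (Finset.univ : Finset (Fin 2))).image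
      fun p => p.1 ++ [p.2] := by
    have aux : ∀ w a, (w ++ [a]).length = k + 1 → Normal r w → w ++ [a] ∈
        (normalWords r k ×ˢ (Finset.univ : Finset (Fin 2))).image fun p => p.1 ++ [p.2] := by
      intro w a hl hw
      exact Finset.mem_image.2 ⟨(w, a), by simpa using ⟨by simpa using hl, hw⟩, rfl⟩
    intro w hw
    rcases Finset.mem_union.1 hw with hw | hw
    · obtain ⟨hl, hn⟩ := mem_normalWords.1 hw
      rcases List.eq_nil_or_concat w with rfl | ⟨v, a, rfl⟩
      · simp at hl
      · rw [List.concat_eq_append] at *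
        exact aux v a hl (hn.of_infix (List.prefix_append _ _).isInfix)
    rcases Finset.mem_union.1 hw with hw | hw
    · obtain ⟨u, hu, rfl⟩ := Finset.mem_image.1 hw
      rw [mem_normalWords] at hu
      rw [leadX_eq, ← List.append_assoc]
      refine aux _ _ ?_ (hu.2.append_replicate _)
      simp
      omega
    · obtain ⟨u, hu, rfl⟩ := Finset.mem_image.1 hw
      rw [Finset.mem_filter, mem_normalWords] at hu
      rw [leadY_eq, ← List.append_assoc, ← List.append_assoc]
      refine aux _ _ ?_ (hu.1.2.append_replicate_zero hu.2)
      simp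
      omega
  have := (Finset.card_le_card hsub).trans Finset.card_image_le
  rw [Finset.card_union_of_disjoint dA, Finset.card_union_of_disjoint dBC, cB, cC,
    Finset.card_product, Finset.card_univ, Fintype.card_fin] at this
  omega

/-! ### Comparing the ideal with the normal words -/

section Field

variable {L : Type*} [Field L]

/-- If the normal words span the quotient in every degree, then the dimension of the ideal in
degree `k` is at most the number of words that are not normal. -/
lemma finrank_relSpan_add_card_le {r : ℕ} {c : List (Fin 2) → L}
    (hc : ∀ (a : Fin 2) (w : List (Fin 2)), c (a :: w) = c (w ++ [a]))
    (hS : ∀ m, wordSpan L (words m) ≤ relSpan (r + 3) c m ⊔ wordSpan L (normalWords r m))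
    (k : ℕ) : Module.finrank L (relSpan (r + 3) c k) + (normalWords r k).card ≤ 2 ^ k := by
  classical
  have base : ∀ k, (normalWords r k).card ≤ 2 ^ k := fun k => by
    rw [← card_words k]
    exact Finset.card_le_card (Finset.filter_subset _ _)
  have small : ∀ k < r + 3, Module.finrank L (relSpan (r + 3) c k) = 0 := by
    intro k hk
    have : relSpan (r + 3) c k = ⊥ := by
      rw [eq_bot_iff]
      exact relSpan_le fun i u v h => by omega
    rw [this, finrank_bot]
  induction k with
  | zero =>
    rw [small 0 (by omega), zero_add]
    exact base 0
  | succ k ih =>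
    by_cases hk : k + 1 < r + 3
    · rw [small _ hk, zero_add]
      exact base _
    · obtain ⟨m, hm⟩ := Nat.exists_eq_add_of_le' (not_lt.1 hk)
      have h1 := finrank_relSpan_succ_le (by omega) hm.symm hc (normalWords r m)
        (fun u hu => (mem_normalWords.1 hu).1) (hS m)
      have h2 := card_normalWords_succ hm.symm
      have h3 : 2 ^ (k + 1) = 2 * 2 ^ k := by ring
      omega

end Field

/-! ### A potential for which the normal words span -/

section Model

/-- The coefficient function of the sum of all words with exactly two letters `x`. -/
def modelCoeff (R : Type*) [CommRing R] (w : List (Fin 2)) : R := if w.count 0 = 2 then 1 else 0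

lemma modelCoeff_cons (R : Type*) [CommRing R] (a : Fin 2) (w : List (Fin 2)) :
    modelCoeff R (a :: w) = modelCoeff R (w ++ [a]) := by
  simp [modelCoeff, List.count_cons, List.count_append]

/-- The sum of the positions of the letters `x`. -/
def posSum : List (Fin 2) → ℕ
  | [] => 0
  | _ :: w => posSum w + w.count 0

lemma posSum_append (u v : List (Fin 2)) :
    posSum (u ++ v) = posSum u + u.length * v.count 0 + posSum v := by
  induction u with
  | nil => simp [posSum]
  | cons a u ih =>
    simp only [List.cons_append, posSum, ih, List.count_append, List.length_cons]
    ring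

lemma posSum_of_count_eq_zero {w : List (Fin 2)} (h : w.count 0 = 0) : posSum w = 0 := by
  induction w with
  | nil => rfl
  | cons a w ih =>
    have : w.count 0 = 0 := by rw [List.count_cons] at h; omega
    simp [posSum, ih this, this]

/-- Positions count from 0, so the unique maximizer has its `x` at the very end. This makes `leadX
r` the leading word of the model's `∂_x`; the analogue for two letters `x` serves `leadY r`. -/
lemma posSum_of_count_eq_one {w : List (Fin 2)} (h : w.count 0 = 1) :
    posSum w + 1 < w.length ∨ (posSum w + 1 = w.length ∧
      w = List.replicate (w.length - 1) 1 ++ [0]) := by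
  induction w with
  | nil => simp at h
  | cons a w ih =>
    have ha : a = 0 ∨ a = 1 := by omega
    rcases ha with rfl | rfl
    · have h0 : w.count 0 = 0 := by simpa using h
      rcases w with _ | ⟨b, w⟩
      · right; simp [posSum]
      · left
        simp only [posSum] at *
        have := posSum_of_count_eq_zero h0
        simp only [posSum] at this
        simp [h0]; omega
    · have h0 : w.count 0 = 1 := by simpa using h
      have hpos : 0 < w.length :=
        List.length_pos_of_mem (List.count_pos_iff.1 (by omega : 0 < w.count 0))
      rcases ih h0 with h1 | ⟨h1, h2⟩
      · left; simp [posSum, h0]; omega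
      · right
        refine ⟨by simp [posSum, h0]; omega, ?_⟩
        conv_lhs => rw [h2]
        rw [← List.cons_append, ← List.replicate_succ]
        congr 2
        simp; omega

lemma posSum_of_count_eq_two {w : List (Fin 2)} (h : w.count 0 = 2) :
    posSum w + 3 < 2 * w.length ∨ (posSum w + 3 = 2 * w.length ∧
      w = List.replicate (w.length - 2) 1 ++ [0, 0]) := by
  induction w with
  | nil => simp at h
  | cons a w ih =>
    have hpos : 1 ≤ w.length := by
      by_contra h0
      have : w = [] := List.length_eq_zero_iff.1 (by omega)
      subst this
      have := List.count_le_length (a := (0 : Fin 2)) (l := [a])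
      simp at this
      omega
    have ha : a = 0 ∨ a = 1 := by omega
    rcases ha with rfl | rfl
    · have h0 : w.count 0 = 1 := by simpa using h
      rcases posSum_of_count_eq_one h0 with h1 | ⟨h1, h2⟩
      · left; simp [posSum, h0]; omega
      · by_cases hw : w.length = 1
        · right
          rw [hw] at h2
          subst h2
          simp [posSum]
        · left; simp [posSum, h0]; omega
    · have h0 : w.count 0 = 2 := by simpa using h
      have hl : 2 ≤ w.length := h0.symm.le.trans List.count_le_length
      rcases ih h0 with h1 | ⟨h1, h2⟩
      · left; simp [posSum, h0]; omega
      · right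
        refine ⟨by simp [posSum, h0]; omega, ?_⟩
        conv_lhs => rw [h2]
        rw [← List.cons_append, ← List.replicate_succ]
        congr 2
        simp; omega

variable (R : Type*) [CommRing R]

/-- One rewriting step: `s` occurs in the relation with coefficient 1, and all other words there
have the same number of `x` and smaller `posSum`. By `posSum_append` the comparison survives
multiplication by `u` and `v`. -/
lemma relElt_model_sub_mem {r : ℕ} (i : Fin 2) {s : List (Fin 2)} (hs : s.length = r + 3)
    (hcs : (i :: s).count 0 = 2)
    (hmax : ∀ w : List (Fin 2), w.length = r + 3 → w.count 0 = s.count 0 → w ≠ s →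
      posSum w < posSum s) (u v : List (Fin 2)) :
    single (u ++ s ++ v) (1 : R) ∈ relSpan (r + 3) (modelCoeff R) (u ++ s ++ v).length ⊔
      wordSpan R {w | w.length = (u ++ s ++ v).length ∧ posSum w < posSum (u ++ s ++ v)} := by
  classical
  have h1 : relElt (r + 3) (modelCoeff R) i u v = single (u ++ s ++ v) (1 : R) +
      ∑ w ∈ (words (r + 3)).erase s, single (u ++ w ++ v) (modelCoeff R (i :: w)) := by
    rw [relElt, ← Finset.add_sum_erase _ _ (by simpa using hs)]
    congr 2
    rw [modelCoeff, if_pos hcs]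
  rw [← sub_eq_iff_eq_add] at h1
  rw [← h1]
  refine sub_mem (mem_sup_left (relElt_mem _ i (by simp; omega))) (mem_sup_right ?_)
  refine sum_mem fun w hw => ?_
  rw [Finset.mem_erase, mem_words] at hw
  by_cases hcw : (i :: w).count 0 = 2
  · have hc : w.count 0 = s.count 0 := by simp only [List.count_cons] at hcs hcw; omega
    refine single_mem_wordSpan (Set.mem_ofPred.2 ⟨by simp; omega, ?_⟩) _
    have := hmax w hw.2 hc hw.1
    simp only [posSum_append, List.length_append, hw.2, hs, hc]
    omega
  · simp [modelCoeff, hcw]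

/-- Strong induction on `posSum`: a word that is not normal contains a leading word and is rewritten
into words of smaller `posSum`. No confluence is needed, only spanning. -/
lemma wordSpan_le_model (r k : ℕ) : wordSpan R (words k) ≤
    relSpan (r + 3) (modelCoeff R) k ⊔ wordSpan R (normalWords r k) := by
  have key : ∀ (N : ℕ) (w : List (Fin 2)), w.length = k → posSum w = N →
      single w (1 : R) ∈ relSpan (r + 3) (modelCoeff R) k ⊔ wordSpan R (normalWords r k) := by
    intro N
    induction N using Nat.strong_induction_on with
    | _ N ih =>
      intro w hw hN
      have step : ∀ (i : Fin 2) (s : List (Fin 2)), s.length = r + 3 → (i :: s).count 0 = 2 →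
          (∀ w : List (Fin 2), w.length = r + 3 → w.count 0 = s.count 0 → w ≠ s →
            posSum w < posSum s) → s <:+: w →
          single w (1 : R) ∈ relSpan (r + 3) (modelCoeff R) k ⊔ wordSpan R (normalWords r k) := by
        rintro i s hs hcs hmax ⟨u, v, rfl⟩
        have h := relElt_model_sub_mem R i hs hcs hmax u v
        rw [hw, hN] at h
        refine (show _ ≤ relSpan (r + 3) (modelCoeff R) k ⊔ wordSpan R (normalWords r k) from
          sup_le le_sup_left ?_) h
        rw [wordSpan, span_le]
        rintro _ ⟨w', ⟨hw', hp⟩, rfl⟩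
        exact ih _ hp w' hw' rfl
      by_cases hX : leadX r <:+: w
      · refine step 0 (leadX r) (by simp [leadX]) (by simp [leadX, List.count_replicate]) ?_ hX
        intro v hv hcv hne
        have e : posSum (leadX r) = r + 2 := by
          have h0 : (List.replicate (r + 2) (1 : Fin 2)).count 0 = 0 := by
            simp [List.count_replicate]
          rw [leadX, posSum_append, posSum_of_count_eq_zero h0]
          simp [posSum]
        rcases posSum_of_count_eq_one (w := v)
          (by rw [hcv]; simp [leadX, List.count_replicate]) with h | ⟨_, h⟩
        · omega
        · rw [hv] at h
          exact absurd h hne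
      by_cases hY : leadY r <:+: w
      · refine step 1 (leadY r) (by simp [leadY]) (by simp [leadY, List.count_replicate]) ?_ hY
        intro v hv hcv hne
        have e : posSum (leadY r) = 2 * r + 3 := by
          have h0 : (List.replicate (r + 1) (1 : Fin 2)).count 0 = 0 := by
            simp [List.count_replicate]
          rw [leadY, posSum_append, posSum_of_count_eq_zero h0]
          simp [posSum]
          ring
        rcases posSum_of_count_eq_two (w := v)
          (by rw [hcv]; simp [leadY, List.count_replicate]) with h | ⟨_, h⟩
        · omega
        · rw [hv] at h
          exact absurd h hne
      · exact mem_sup_right (single_mem_wordSpan (by simpa using ⟨hw, hX, hY⟩) 1)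
  rw [wordSpan, span_le]
  rintro _ ⟨w, hw, rfl⟩
  exact key _ w (by simpa using hw) rfl

end Model

end PotentialAlgebra

namespace PotentialAlgebra

open Finsupp Submodule Polynomial

/-! ### Semicontinuity of the dimension of the ideal -/

section Specialization

variable {K L : Type*} [Field K] [Field L] [Algebra K[X] L] [IsFractionRing K[X] L]

/-- Evaluating a polynomial dependence at `a` forces all its coefficients to vanish there; dividing
by `X - a` gives a new dependence, and the argument repeats. -/
lemma pow_dvd_of_eval_independent {ι β : Type*} {v : ι → β →₀ K[X]} {a : K}
    (h : LinearIndependent K fun i => (v i).mapRange (eval a) eval_zero) (s : Finset ι) (m : ℕ) :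
    ∀ g : ι → K[X], (∀ w, ∑ i ∈ s, g i * v i w = 0) → ∀ i ∈ s, (X - C a) ^ m ∣ g i := by
  induction m with
  | zero => simp
  | succ m ih =>
    intro g hg
    have h0 : ∀ i ∈ s, (g i).eval a = 0 := by
      refine linearIndependent_iff'.1 h s (fun i => (g i).eval a) ?_
      ext w
      have := congrArg (eval a) (hg w)
      simpa [eval_finsetSum, Finsupp.finsetSum_apply] using this
    have hd : ∀ i ∈ s, (X - C a) * ((g i) / (X - C a)) = g i := fun i hi =>
      mul_div_eq_iff_isRoot.2 (h0 i hi)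
    intro i hi
    rw [← hd i hi, pow_succ']
    refine mul_dvd_mul_left _ (ih (fun i => g i / (X - C a)) (fun w => ?_) i hi)
    have := hg w
    rw [← Finset.sum_congr rfl fun i hi => by rw [← hd i hi, mul_assoc], ← Finset.mul_sum] at this
    exact (mul_eq_zero.1 this).resolve_left (X_sub_C_ne_zero a)

lemma linearIndependent_of_eval {ι β : Type*} {v : ι → β →₀ K[X]} {a : K}
    (h : LinearIndependent K fun i => (v i).mapRange (eval a) eval_zero) :
    LinearIndependent L fun i => (v i).mapRange (algebraMap K[X] L) (map_zero _) := by
  rw [← LinearIndependent.iff_fractionRing K[X] L, linearIndependent_iff']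
  intro s g hg i hi
  have hg' : ∀ w, ∑ i ∈ s, g i * v i w = 0 := by
    intro w
    apply IsFractionRing.injective K[X] L
    have := DFunLike.congr_fun hg w
    simpa [Finsupp.finsetSum_apply, Algebra.smul_def] using this
  -- A nonzero polynomial is not divisible by a power of `X - a` exceeding its degree.
  by_contra hne
  have hd := pow_dvd_of_eval_independent h s ((g i).natDegree + 1) g hg' i hi
  have := natDegree_le_of_dvd hd hne
  rw [natDegree_pow, natDegree_X_sub_C] at this
  omega

variable (L) in
lemma finrank_span_eval_le {ι β : Type*} (v : ι → β →₀ K[X]) (a : K)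
    [FiniteDimensional K (span K (Set.range fun i => (v i).mapRange (eval a) eval_zero))]
    [FiniteDimensional L
      (span L (Set.range fun i => (v i).mapRange (algebraMap K[X] L) (map_zero _)))] :
    Module.finrank K (span K (Set.range fun i => (v i).mapRange (eval a) eval_zero)) ≤
      Module.finrank L
        (span L (Set.range fun i => (v i).mapRange (algebraMap K[X] L) (map_zero _))) := by
  obtain ⟨f, hf, -, hli⟩ := exists_fun_fin_finrank_span_eq K
    (Set.range fun i => (v i).mapRange (eval a) eval_zero)
  choose g hg using hf
  have h1 : LinearIndependent K fun j => (v (g j)).mapRange (eval a) eval_zero := by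
    rwa [show (fun j => (v (g j)).mapRange (eval a) eval_zero) = f from funext hg]
  have h2 := linearIndependent_of_eval (L := L) h1
  have h3 := finrank_span_eq_card h2
  rw [Fintype.card_fin] at h3
  rw [← h3]
  refine Submodule.finrank_mono (span_mono ?_)
  rintro _ ⟨j, rfl⟩
  exact ⟨g j, rfl⟩

lemma relElt_mapRange {R S : Type*} [CommRing R] [CommRing S] (φ : R →+* S) (l : ℕ)
    (c : List (Fin 2) → R) (i : Fin 2) (u v : List (Fin 2)) :
    (relElt l c i u v).mapRange φ (map_zero φ) = relElt l (fun w => φ (c w)) i u v := by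
  simp only [relElt]
  rw [mapRange_finsetSum]
  simp

/-- The family that spans the ideal together with a set of words. -/
noncomputable def relWordFam {R : Type*} [CommRing R] (l : ℕ) (c : List (Fin 2) → R) (k : ℕ)
    (S : Finset (List (Fin 2))) : RelIdx l k ⊕ S → List (Fin 2) →₀ R :=
  Sum.elim (relFam l c k) fun w => single w.1 1

lemma span_range_relWordFam {R : Type*} [CommRing R] (l : ℕ) (c : List (Fin 2) → R) (k : ℕ)
    (S : Finset (List (Fin 2))) :
    span R (Set.range (relWordFam l c k S)) = relSpan l c k ⊔ wordSpan R S := by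
  rw [relWordFam, Set.Sum.elim_range, span_union, relSpan, wordSpan, Set.image_eq_range]
  rfl

lemma relWordFam_mapRange {R S : Type*} [CommRing R] [CommRing S] (φ : R →+* S) (l : ℕ)
    (c : List (Fin 2) → R) (k : ℕ) (T : Finset (List (Fin 2))) :
    (fun i => (relWordFam l c k T i).mapRange φ (map_zero φ)) =
      relWordFam l (fun w => φ (c w)) k T := by
  ext1 i
  rcases i with i | w
  · exact relElt_mapRange φ l c _ _ _
  · simp [relWordFam]

variable (L) in
lemma finrank_relSpan_sup_wordSpan_le (l : ℕ) (c : List (Fin 2) → K[X]) (k : ℕ)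
    (S : Finset (List (Fin 2))) (a : K) :
    Module.finrank K ((relSpan l (fun w => (c w).eval a) k ⊔ wordSpan K S :
        Submodule K (List (Fin 2) →₀ K))) ≤
      Module.finrank L ((relSpan l (fun w => algebraMap K[X] L (c w)) k ⊔ wordSpan L S :
        Submodule L (List (Fin 2) →₀ L))) := by
  have e1 : (fun i => (relWordFam l c k S i).mapRange (eval a) eval_zero) =
      relWordFam l (fun w => (c w).eval a) k S := relWordFam_mapRange (evalRingHom a) l c k S
  have e2 := relWordFam_mapRange (algebraMap K[X] L) l c k S
  have h := @finrank_span_eval_le K L _ _ _ _ _ _ (relWordFam l c k S) a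
  rw [e1, e2, span_range_relWordFam, span_range_relWordFam] at h
  exact h

lemma wordSpan_empty {R : Type*} [CommRing R] :
    wordSpan R ((∅ : Finset (List (Fin 2))) : Set (List (Fin 2))) = ⊥ := by
  simp [wordSpan]

/-- The dimension of the ideal in degree `k` is at most the number of words that are not normal,
for every potential. -/
theorem finrank_relSpan_add_card_normalWords_le {r : ℕ} {c : List (Fin 2) → K}
    (hc : ∀ (a : Fin 2) (w : List (Fin 2)), c (a :: w) = c (w ++ [a])) (k : ℕ) :
    Module.finrank K (relSpan (r + 3) c k) + (normalWords r k).card ≤ 2 ^ k := by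
  -- The line from the given potential at 0 to the model at 1.
  let p : List (Fin 2) → K[X] := fun w => (1 - X) * C (c w) + X * C (modelCoeff K w)
  let L := FractionRing K[X]
  have hp0 : (fun w => (p w).eval 0) = c := by ext w; simp [p]
  have hp1 : (fun w => (p w).eval 1) = modelCoeff K := by ext w; simp [p]
  have hpc : ∀ (a : Fin 2) (w : List (Fin 2)),
      algebraMap K[X] L (p (a :: w)) = algebraMap K[X] L (p (w ++ [a])) := by
    intro a w
    simp only [p, hc, modelCoeff_cons]
  have hS : ∀ m, wordSpan L (words m) ≤
      relSpan (r + 3) (fun w => algebraMap K[X] L (p w)) m ⊔ wordSpan L (normalWords r m) := by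
    intro m
    have hle : relSpan (r + 3) (fun w => algebraMap K[X] L (p w)) m ⊔
        wordSpan L (normalWords r m) ≤ wordSpan L (words m) := by
      refine sup_le (relSpan_le_wordSpan _ _ _) (span_mono (Set.image_mono ?_))
      intro w hw
      simpa using (mem_normalWords.1 hw).1
    refine (Submodule.eq_of_le_of_finrank_le hle ?_).ge
    -- At 1 the ideal and the normal words fill the whole degree `m` part, so the generic rank is
    -- also full.
    have h1 := finrank_relSpan_sup_wordSpan_le L (r + 3) p m (normalWords r m) 1
    rw [hp1] at h1
    refine le_trans ?_ h1
    rw [finrank_wordSpan, ← finrank_wordSpan (L := K)]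
    exact Submodule.finrank_mono (wordSpan_le_model K r m)
  have h1 := finrank_relSpan_add_card_le (r := r) hpc hS k
  -- The same semicontinuity with no added words, now at 0, carries the generic bound to the given
  -- potential.
  have h2 := finrank_relSpan_sup_wordSpan_le L (r + 3) p k ∅ 0
  rw [hp0, wordSpan_empty, wordSpan_empty, sup_bot_eq, sup_bot_eq] at h2
  exact (Nat.add_le_add_right h2 _).trans h1

end Specialization


/-! ### The Hilbert function of a potential algebra -/

section Link

variable {K : Type*} [Field K]

/-- The identification of the space with basis the words with the free algebra. -/
noncomputable def wordEquiv (K : Type*) [Field K] :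
    (List (Fin 2) →₀ K) ≃ₗ[K] FreeAlgebra K (Fin 2) :=
  Finsupp.domLCongr FreeMonoid.ofList ≪≫ₗ (FreeAlgebra.basisFreeMonoid K (Fin 2)).repr.symm

lemma wordEquiv_single (w : List (Fin 2)) (a : K) :
    wordEquiv K (single w a) = a • monomial K (FreeMonoid.ofList w) := by
  rw [wordEquiv, LinearEquiv.trans_apply, Finsupp.domLCongr_single,
    Module.Basis.repr_symm_single, monomial]

lemma monomial_mul (u v : FreeMonoid (Fin 2)) :
    monomial K u * monomial K v = monomial K (u * v) := by
  simp only [monomial, FreeAlgebra.basisFreeMonoid, Module.Basis.map_apply,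
    Finsupp.coe_basisSingleOne]
  simp [← map_mul]

lemma map_wordEquiv_wordSpan (S : Set (List (Fin 2))) :
    (wordSpan K S).map (wordEquiv K).toLinearMap =
      span K (monomial K '' {w | w.toList ∈ S}) := by
  rw [wordSpan, map_span, Set.image_image]
  congr 1
  ext e
  constructor
  · rintro ⟨w, hw, rfl⟩
    exact ⟨FreeMonoid.ofList w, hw, by simp [wordEquiv_single]⟩
  · rintro ⟨w, hw, rfl⟩
    exact ⟨w.toList, hw, by simp [wordEquiv_single]⟩

lemma homogeneousPart_eq (k : ℕ) :
    homogeneousPart K k = (wordSpan K (words k)).map (wordEquiv K).toLinearMap := by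
  rw [map_wordEquiv_wordSpan, homogeneousPart]
  congr 2
  ext w
  simp [FreeMonoid.length]

lemma pderiv_monomial (i : Fin 2) (w : FreeMonoid (Fin 2)) :
    pderiv K i (monomial K w) = wordDeriv K i w.toList :=
  Module.Basis.constr_basis _ _ _ _

lemma pderiv_eq {l : ℕ} {F : FreeAlgebra K (Fin 2)} (hF : F ∈ homogeneousPart K (l + 1))
    (i : Fin 2) : pderiv K i F =
      ∑ w ∈ words l, coeff F (FreeMonoid.ofList (i :: w)) • monomial K (FreeMonoid.ofList w) := by
  let P : FreeAlgebra K (Fin 2) →ₗ[K] FreeAlgebra K (Fin 2) := ∑ w ∈ words l,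
    (((Finsupp.lapply (FreeMonoid.ofList (i :: w))).comp
      (FreeAlgebra.basisFreeMonoid K (Fin 2)).repr.toLinearMap).smulRight
        (monomial K (FreeMonoid.ofList w)))
  have hP : ∀ G, P G =
      ∑ w ∈ words l, coeff G (FreeMonoid.ofList (i :: w)) • monomial K (FreeMonoid.ofList w) := by
    intro G
    simp [P, coeff]
  rw [← hP]
  revert F
  suffices homogeneousPart K (l + 1) ≤ LinearMap.eqLocus (pderiv K i) P from fun {F} hF => this hF
  rw [homogeneousPart, span_le]
  rintro _ ⟨w, hw, rfl⟩
  rw [SetLike.mem_coe, LinearMap.mem_eqLocus, hP, pderiv_monomial]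
  classical
  have hc : ∀ v, coeff (monomial K w) v = if w = v then 1 else 0 := by
    intro v
    rw [coeff, monomial, Module.Basis.repr_self, Finsupp.single_apply]
  induction w using FreeMonoid.casesOn with
  | one => simp at hw
  | of_mul j u =>
    have hu : u.toList.length = l := by
      have h : (FreeMonoid.of j * u).length = l + 1 := hw
      rw [FreeMonoid.length_mul, FreeMonoid.length_of, add_comm] at h
      exact Nat.succ_injective h
    simp only [hc]
    rw [Finset.sum_eq_single u.toList]
    · by_cases hj : j = i
      · subst hj
        simp [wordDeriv]
      · have : FreeMonoid.of j * u ≠ FreeMonoid.ofList (i :: u.toList) := fun h =>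
          hj (List.cons.inj h).1
        rw [if_neg this, zero_smul]
        exact if_neg hj
    · intro v _ hv
      have : FreeMonoid.of j * u ≠ FreeMonoid.ofList (i :: v) := fun h =>
        hv (List.cons.inj h).2.symm
      rw [if_neg this, zero_smul]
    · intro h
      simp [hu] at h

/-- The coefficient function of `F` on words. -/
noncomputable def wordCoeff (F : FreeAlgebra K (Fin 2)) (w : List (Fin 2)) : K :=
  coeff F (FreeMonoid.ofList w)

lemma wordCoeff_cons {F : FreeAlgebra K (Fin 2)} (hF : IsCyclicallyInvariant F) (a : Fin 2)
    (w : List (Fin 2)) : wordCoeff F (a :: w) = wordCoeff F (w ++ [a]) :=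
  hF (FreeMonoid.of a) (FreeMonoid.ofList w)

lemma wordEquiv_relElt {l : ℕ} {F : FreeAlgebra K (Fin 2)} (hF : F ∈ homogeneousPart K (l + 1))
    (i : Fin 2) (u v : List (Fin 2)) :
    wordEquiv K (relElt l (wordCoeff F) i u v) =
      monomial K (FreeMonoid.ofList u) * pderiv K i F * monomial K (FreeMonoid.ofList v) := by
  rw [pderiv_eq hF, relElt, map_sum, Finset.mul_sum, Finset.sum_mul]
  refine Finset.sum_congr rfl fun w _ => ?_
  rw [wordEquiv_single, mul_smul_comm, smul_mul_assoc, monomial_mul, monomial_mul]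
  rfl

/-- The two-sided ideal generated by the cyclic derivatives, as a subspace. -/
noncomputable def relIdeal (F : FreeAlgebra K (Fin 2)) : Submodule K (FreeAlgebra K (Fin 2)) :=
  span K (Set.range fun p : Fin 2 × FreeMonoid (Fin 2) × FreeMonoid (Fin 2) =>
    monomial K p.2.1 * pderiv K p.1 F * monomial K p.2.2)

lemma span_monomial : span K (Set.range (monomial K)) = ⊤ :=
  (FreeAlgebra.basisFreeMonoid K (Fin 2)).span_eq

lemma mul_mem_relIdeal_left {F : FreeAlgebra K (Fin 2)} (z : FreeAlgebra K (Fin 2))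
    {e : FreeAlgebra K (Fin 2)} (he : e ∈ relIdeal F) : z * e ∈ relIdeal F := by
  have hz : z ∈ span K (Set.range (monomial K)) := by
    rw [span_monomial]
    exact mem_top
  induction hz using span_induction with
  | mem z hz =>
    obtain ⟨w, rfl⟩ := hz
    have : relIdeal F ≤ (relIdeal F).comap (LinearMap.mulLeft K (monomial K w)) := by
      conv_lhs => rw [relIdeal]
      rw [span_le]
      rintro _ ⟨⟨i, u, v⟩, rfl⟩
      simp only [SetLike.mem_coe, mem_comap, LinearMap.mulLeft_apply, ← mul_assoc, monomial_mul]
      exact subset_span ⟨(i, w * u, v), rfl⟩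
    exact this he
  | zero => simp
  | add x y _ _ hx hy => rw [add_mul]; exact add_mem hx hy
  | smul a x _ hx => rw [smul_mul_assoc]; exact smul_mem _ _ hx

lemma mul_mem_relIdeal_right {F : FreeAlgebra K (Fin 2)} (z : FreeAlgebra K (Fin 2))
    {e : FreeAlgebra K (Fin 2)} (he : e ∈ relIdeal F) : e * z ∈ relIdeal F := by
  have hz : z ∈ span K (Set.range (monomial K)) := by
    rw [span_monomial]
    exact mem_top
  induction hz using span_induction with
  | mem z hz =>
    obtain ⟨w, rfl⟩ := hz
    have : relIdeal F ≤ (relIdeal F).comap (LinearMap.mulRight K (monomial K w)) := by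
      conv_lhs => rw [relIdeal]
      rw [span_le]
      rintro _ ⟨⟨i, u, v⟩, rfl⟩
      simp only [SetLike.mem_coe, mem_comap, LinearMap.mulRight_apply, mul_assoc, monomial_mul]
      exact subset_span ⟨(i, u, v * w), by simp [mul_assoc]⟩
    exact this he
  | zero => simp
  | add x y _ _ hx hy => rw [mul_add]; exact add_mem hx hy
  | smul a x _ hx => rw [mul_smul_comm]; exact smul_mem _ _ hx

lemma pderiv_mem_relIdeal (F : FreeAlgebra K (Fin 2)) (i : Fin 2) :
    pderiv K i F ∈ relIdeal F := by
  have h1 : monomial K 1 = 1 := by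
    simp only [monomial, FreeAlgebra.basisFreeMonoid, Module.Basis.map_apply,
      Finsupp.coe_basisSingleOne]
    exact map_one FreeAlgebra.equivMonoidAlgebraFreeMonoid.symm
  exact subset_span ⟨(i, 1, 1), by simp [h1]⟩

/-- Differences of elements identified in `RingQuot` stay in `relIdeal F`, since it is closed under
multiplication on both sides. -/
lemma toPotAlg_eq_zero_imp {F z : FreeAlgebra K (Fin 2)} (hz : toPotAlg F z = 0) :
    z ∈ relIdeal F := by
  have hR : ∀ a b, RingQuot.Rel (Rel F) a b → a - b ∈ relIdeal F := by
    intro a b h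
    induction h with
    | of h =>
      obtain ⟨i⟩ := h
      simpa using pderiv_mem_relIdeal F i
    | add_left _ ih => simpa using ih
    | mul_left _ ih => rw [← sub_mul]; exact mul_mem_relIdeal_right _ ih
    | mul_right _ ih => rw [← mul_sub]; exact mul_mem_relIdeal_left _ ih
  have hE : ∀ a b, Relation.EqvGen (RingQuot.Rel (Rel F)) a b → a - b ∈ relIdeal F := by
    intro a b h
    induction h with
    | rel a b h => exact hR a b h
    | refl => simp
    | symm _ _ _ ih => simpa using neg_mem ih
    | trans _ _ _ _ _ ih1 ih2 => simpa using add_mem ih1 ih2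
  have h0 : toPotAlg F z = toPotAlg F 0 := by rw [hz, map_zero]
  rw [toPotAlg, RingQuot.mkAlgHom_def] at h0
  have h1 : Quot.mk (RingQuot.Rel (Rel F)) z = Quot.mk (RingQuot.Rel (Rel F)) 0 := by
    simpa [RingQuot.mkRingHom_def] using h0
  simpa using hE z 0 (Quot.eqvGen_exact h1)

/-- The projection to the degree `k` component. -/
noncomputable def degreeProj (K : Type*) [Field K] (k : ℕ) :
    (List (Fin 2) →₀ K) →ₗ[K] (List (Fin 2) →₀ K) :=
  Finsupp.linearCombination K fun w => if w.length = k then single w 1 else 0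

lemma degreeProj_of_mem {k j : ℕ} {e : List (Fin 2) →₀ K} (he : e ∈ wordSpan K (words j)) :
    degreeProj K k e = if j = k then e else 0 := by
  rw [wordSpan] at he
  induction he using span_induction with
  | mem e he =>
    obtain ⟨w, hw, rfl⟩ := he
    have hw : w.length = j := by simpa using hw
    simp [degreeProj, hw]
  | zero => simp
  | add x y _ _ hx hy => rw [map_add, hx, hy]; split_ifs <;> simp
  | smul a x _ hx => rw [map_smul, hx]; split_ifs <;> simp

/-- The ideal is spanned by homogeneous elements, so projecting to degree `k` keeps only the
generators of that degree. -/
lemma mem_relSpan_of_toPotAlg_eq_zero {l k : ℕ} {F : FreeAlgebra K (Fin 2)}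
    (hF : F ∈ homogeneousPart K (l + 1)) {e : List (Fin 2) →₀ K}
    (he : e ∈ wordSpan K (words k)) (hz : toPotAlg F (wordEquiv K e) = 0) :
    e ∈ relSpan l (wordCoeff F) k := by
  have h : relIdeal F ≤
      ((relSpan l (wordCoeff F) k).comap (degreeProj K k)).map (wordEquiv K).toLinearMap := by
    rw [relIdeal, span_le]
    rintro _ ⟨⟨i, u, v⟩, rfl⟩
    refine ⟨relElt l (wordCoeff F) i u.toList v.toList, ?_, wordEquiv_relElt hF i _ _⟩
    have h1 := relElt_mem (wordCoeff F) i (u := u.toList) (v := v.toList) (l := l) rfl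
    rw [SetLike.mem_coe, mem_comap, degreeProj_of_mem (relSpan_le_wordSpan _ _ _ h1)]
    split_ifs with hk
    · rwa [hk] at h1
    · exact zero_mem _
  obtain ⟨e', he', hee⟩ := h (toPotAlg_eq_zero_imp hz)
  obtain rfl := (wordEquiv K).injective hee
  rw [SetLike.mem_coe, mem_comap, degreeProj_of_mem he, if_pos rfl] at he'
  exact he'

lemma finrank_le_finrank_map_add {V M : Type*} [AddCommGroup V] [Module K V] [AddCommGroup M]
    [Module K M] (f : V →ₗ[K] M) (W J : Submodule K V) [FiniteDimensional K W]
    [FiniteDimensional K J] (h : ∀ e ∈ W, f e = 0 → e ∈ J) :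
    Module.finrank K W ≤ Module.finrank K (W.map f) + Module.finrank K J := by
  rw [← (f.domRestrict W).finrank_range_add_finrank_ker, LinearMap.range_domRestrict]
  refine Nat.add_le_add_left ?_ _
  rw [← LinearMap.finrank_range_of_inj (f := W.subtype.domRestrict (LinearMap.ker
    (f.domRestrict W))) (fun x y hxy => Subtype.ext (Subtype.ext hxy))]
  refine Submodule.finrank_mono ?_
  rintro _ ⟨⟨e, he⟩, rfl⟩
  exact h e e.2 he

lemma two_pow_le_hilbertFn_add {l k : ℕ} {F : FreeAlgebra K (Fin 2)}
    (hF : F ∈ homogeneousPart K (l + 1)) :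
    2 ^ k ≤ hilbertFn F k + Module.finrank K (relSpan l (wordCoeff F) k) := by
  rw [hilbertFn, homogeneousPart_eq, ← Submodule.map_comp, ← card_words,
    ← finrank_wordSpan (L := K)]
  exact finrank_le_finrank_map_add _ _ _ fun e he h0 => mem_relSpan_of_toPotAlg_eq_zero hF he h0

/-- The Hilbert function of a potential algebra is at least the number of normal words. -/
theorem card_normalWords_le_hilbertFn {r : ℕ} {F : FreeAlgebra K (Fin 2)}
    (hF : IsHomogeneousPotential (r + 4) F) (k : ℕ) : (normalWords r k).card ≤ hilbertFn F k := by
  have h1 := two_pow_le_hilbertFn_add (l := r + 3) (k := k) hF.1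
  have h2 := finrank_relSpan_add_card_normalWords_le (r := r) (wordCoeff_cons hF.2) k
  omega

instance (F : FreeAlgebra K (Fin 2)) (k : ℕ) :
    FiniteDimensional K ((filteredPart K k).map (toPotAlg F).toLinearMap) := by
  have : FiniteDimensional K (filteredPart K k) :=
    FiniteDimensional.span_of_finite K ((List.finite_length_le (Fin 2) k).image _)
  infer_instance

lemma hilbertFn_le_growthFn (F : FreeAlgebra K (Fin 2)) {j k : ℕ} (h : j ≤ k) :
    hilbertFn F j ≤ growthFn F k := by
  refine Submodule.finrank_mono (Submodule.map_mono (span_mono (Set.image_mono ?_)))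
  intro w hw
  exact (show w.length = j from hw).le.trans h

end Link


/-! ### A potential attaining the minimal growth -/

section ModelPotential

variable {K : Type*} [Field K]

/-- The sum of all words of length `n` with exactly two letters `x`. -/
noncomputable def modelPotential (K : Type*) [Field K] (n : ℕ) : FreeAlgebra K (Fin 2) :=
  wordEquiv K (∑ w ∈ words n, single w (modelCoeff K w))

lemma coeff_modelPotential (n : ℕ) (w : FreeMonoid (Fin 2)) :
    coeff (modelPotential K n) w = if w.length = n then modelCoeff K w.toList else 0 := by
  classical
  have h : ∀ e : List (Fin 2) →₀ K, coeff (wordEquiv K e) w = e w.toList := by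
    intro e
    rw [coeff, wordEquiv, LinearEquiv.trans_apply, LinearEquiv.apply_symm_apply,
      Finsupp.domLCongr_apply]
    rfl
  rw [modelPotential, h, Finsupp.finsetSum_apply]
  simp only [Finsupp.single_apply, Finset.sum_ite_eq', mem_words]
  rfl

lemma modelPotential_isHomogeneousPotential (n : ℕ) :
    IsHomogeneousPotential n (modelPotential K n) := by
  constructor
  · rw [homogeneousPart_eq]
    exact mem_map_of_mem (sum_mem fun w hw => single_mem_wordSpan hw _)
  · intro u v
    rw [coeff_modelPotential, coeff_modelPotential]
    simp [modelCoeff, FreeMonoid.length_mul, add_comm]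

lemma toPotAlg_wordEquiv_relElt (l : ℕ) (i : Fin 2) (u v : List (Fin 2)) :
    toPotAlg (modelPotential K (l + 1)) (wordEquiv K (relElt l (modelCoeff K) i u v)) = 0 := by
  have h : relElt l (modelCoeff K) i u v =
      relElt l (wordCoeff (modelPotential K (l + 1))) i u v := by
    refine Finset.sum_congr rfl fun w hw => ?_
    rw [mem_words] at hw
    rw [wordCoeff, coeff_modelPotential, if_pos (by simp [FreeMonoid.length, hw])]
    rfl
  have h0 : toPotAlg (modelPotential K (l + 1)) (pderiv K i (modelPotential K (l + 1))) = 0 := by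
    rw [← map_zero (toPotAlg (modelPotential K (l + 1)))]
    exact RingQuot.mkAlgHom_rel K (Rel.of i)
  rw [h, wordEquiv_relElt (modelPotential_isHomogeneousPotential _).1, map_mul, map_mul, h0,
    mul_zero, zero_mul]

lemma growthFn_modelPotential_le (r k : ℕ) :
    growthFn (modelPotential K (r + 4)) k ≤
      ∑ j ∈ Finset.range (k + 1), (normalWords r j).card := by
  classical
  set F := modelPotential K (r + 4)
  let f : (List (Fin 2) →₀ K) →ₗ[K] PotAlg F :=
    (toPotAlg F).toLinearMap.comp (wordEquiv K).toLinearMap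
  set S := (Finset.range (k + 1)).biUnion (normalWords r)
  have hmap : (filteredPart K k).map (toPotAlg F).toLinearMap ≤ (wordSpan K S).map f := by
    rw [filteredPart, map_span, span_le]
    rintro _ ⟨_, ⟨w, hw, rfl⟩, rfl⟩
    have hw : w.length ≤ k := hw
    have h1 := wordSpan_le_model K r w.length
      (single_mem_wordSpan (R := K) (w := w.toList) (by simp [FreeMonoid.length]) 1)
    have h2 : relSpan (r + 3) (modelCoeff K) w.length ⊔ wordSpan K (normalWords r w.length) ≤
        ((wordSpan K S).map f).comap f := by
      refine sup_le (relSpan_le fun i u v _ => ?_) ?_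
      · have h0 : f (relElt (r + 3) (modelCoeff K) i u v) = 0 := toPotAlg_wordEquiv_relElt _ _ _ _
        rw [mem_comap, h0]
        exact zero_mem _
      · rw [← map_le_iff_le_comap]
        refine map_mono (span_mono (Set.image_mono ?_))
        exact Finset.coe_subset.2 (Finset.subset_biUnion_of_mem (normalWords r)
          (Finset.mem_range.2 (by omega)))
    have h3 := h2 h1
    rw [mem_comap] at h3
    simpa [f, wordEquiv_single] using h3
  calc growthFn F k ≤ Module.finrank K ((wordSpan K (S : Set (List (Fin 2)))).map f) :=
        Submodule.finrank_mono hmap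
    _ ≤ Module.finrank K (wordSpan K (S : Set (List (Fin 2)))) := Submodule.finrank_map_le _ _
    _ = S.card := finrank_wordSpan S
    _ ≤ _ := Finset.card_biUnion_le

end ModelPotential

/-! ### Counting normal words -/

section Count

/-- The word `x ^ i (y x) ^ j y ^ l`. -/
def stdWord (i j l : ℕ) : List (Fin 2) :=
  List.replicate i 0 ++ ((List.replicate j [1, 0]).flatten ++ List.replicate l 1)

lemma length_stdWord (i j l : ℕ) : (stdWord i j l).length = i + (2 * j + l) := by
  simp [stdWord, mul_comm]

lemma normal_zero_cons {a : Fin 2} {w : List (Fin 2)} :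
    Normal 0 (a :: w) ↔ Normal 0 w ∧ (a = 1 → ¬ [1, 0] <+: w ∧ ¬ [0, 0] <+: w) := by
  have hX : leadX 0 = [1, 1, 0] := rfl
  have hY : leadY 0 = [1, 0, 0] := rfl
  rw [Normal, Normal, hX, hY, List.infix_cons_iff, List.infix_cons_iff, List.cons_prefix_cons,
    List.cons_prefix_cons, eq_comm (a := a)]
  tauto

/-- Prepending `y` to `x^i (yx)^j y^l` creates `yxx` if `i ≥ 2` and `yyx` if `i = 0 < j`; otherwise
it yields one more `yx` or one more final `y`. -/
lemma Normal.exists_eq_stdWord {w : List (Fin 2)} (hw : Normal 0 w) :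
    ∃ i j l, w = stdWord i j l := by
  induction w with
  | nil => exact ⟨0, 0, 0, rfl⟩
  | cons a w ih =>
    rw [normal_zero_cons] at hw
    obtain ⟨i, j, l, rfl⟩ := ih hw.1
    have ha : a = 0 ∨ a = 1 := by omega
    rcases ha with rfl | rfl
    · exact ⟨i + 1, j, l, by simp [stdWord, List.replicate_succ]⟩
    · have h := hw.2 rfl
      rcases i with _ | _ | i
      · rcases j with _ | j
        · exact ⟨0, 0, l + 1, by simp [stdWord, List.replicate_succ]⟩
        · exact absurd (by simp [stdWord, List.replicate_succ]) h.1
      · exact ⟨0, j + 1, l, by simp [stdWord, List.replicate_succ]⟩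
      · exact absurd (by simp [stdWord, List.replicate_succ]) h.2

lemma normal_stdWord (i j l : ℕ) : Normal 0 (stdWord i j l) := by
  induction i with
  | succ i ih =>
    have : stdWord (i + 1) j l = 0 :: stdWord i j l := by simp [stdWord, List.replicate_succ]
    rw [this, normal_zero_cons]
    exact ⟨ih, by simp⟩
  | zero =>
    induction j with
    | succ j ih =>
      have : stdWord 0 (j + 1) l = 1 :: 0 :: stdWord 0 j l := by
        simp [stdWord, List.replicate_succ]
      rw [this, normal_zero_cons, normal_zero_cons]
      refine ⟨⟨ih, by simp⟩, fun _ => ⟨by simp, ?_⟩⟩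
      rcases j with _ | j
      · rcases l with _ | l <;> simp [stdWord, List.replicate_succ]
      · simp [stdWord, List.replicate_succ]
    | zero =>
      induction l with
      | zero => simp [stdWord, Normal, leadX, leadY]
      | succ l ih =>
        have : stdWord 0 0 (l + 1) = 1 :: stdWord 0 0 l := by simp [stdWord, List.replicate_succ]
        rw [this, normal_zero_cons]
        refine ⟨ih, fun _ => ?_⟩
        rcases l with _ | _ | l <;> simp [stdWord, List.replicate_succ]

lemma card_normalWords_zero_le (k : ℕ) : (normalWords 0 k).card ≤ (k + 1) ^ 2 := by
  classical
  have h : normalWords 0 k ⊆ (Finset.range (k + 1) ×ˢ Finset.range (k + 1)).image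
      fun p => stdWord p.1 p.2 (k - (p.1 + 2 * p.2)) := by
    intro w hw
    obtain ⟨hl, hn⟩ := mem_normalWords.1 hw
    obtain ⟨i, j, l, rfl⟩ := hn.exists_eq_stdWord
    rw [length_stdWord] at hl
    refine Finset.mem_image.2 ⟨(i, j), ?_, ?_⟩
    · simp; omega
    · dsimp only
      congr 1
      omega
  refine (Finset.card_le_card h).trans (Finset.card_image_le.trans ?_)
  simp [sq]

lemma takeWhile_stdWord (i j l : ℕ) :
    (stdWord i j l).takeWhile (· == 0) = List.replicate i 0 := by
  rw [stdWord, List.takeWhile_append_of_pos (by simp)]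
  rcases j with _ | j
  · rcases l with _ | l <;> simp [List.replicate_succ]
  · simp [List.replicate_succ]

lemma count_stdWord (i j l : ℕ) : (stdWord i j l).count 0 = i + j := by
  simp [stdWord, List.count_flatten, List.count_replicate]

lemma sq_le_card_normalWords_zero (k : ℕ) : (k / 4 + 1) ^ 2 ≤ (normalWords 0 k).card := by
  classical
  -- The initial run of `x` recovers `i` and the number of `x` recovers `i + j`. For `i, j ≤ k / 4`
  -- the subtraction does not truncate, so the length is `k`.
  set f : ℕ × ℕ → List (Fin 2) := fun p => stdWord p.1 p.2 (k - (p.1 + 2 * p.2)) with hf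
  have hinj : Function.Injective f := by
    rintro ⟨i, j⟩ ⟨i', j'⟩ h
    have h1 := congrArg (fun w => (w.takeWhile (· == 0)).length) h
    have h2 := congrArg (List.count 0) h
    simp only [hf, takeWhile_stdWord, List.length_replicate, count_stdWord] at h1 h2
    simp only [Prod.mk.injEq]
    omega
  have h : (Finset.range (k / 4 + 1) ×ˢ Finset.range (k / 4 + 1)).image f ⊆ normalWords 0 k := by
    intro w hw
    obtain ⟨⟨i, j⟩, hp, rfl⟩ := Finset.mem_image.1 hw
    simp only [Finset.mem_product, Finset.mem_range] at hp
    rw [mem_normalWords, length_stdWord]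
    exact ⟨by omega, normal_stdWord _ _ _⟩
  have := Finset.card_le_card h
  rw [Finset.card_image_of_injective _ hinj] at this
  simpa [sq] using this

/-- For `r ≥ 1` both leading words begin with `yy`; this is where degree 5 departs from degree 4. -/
lemma normal_of_not_infix {r : ℕ} (hr : 1 ≤ r) {w : List (Fin 2)} (hw : ¬ [1, 1] <:+: w) :
    Normal r w := by
  obtain ⟨s, rfl⟩ := Nat.exists_eq_add_of_le' hr
  refine ⟨fun h => hw (List.IsInfix.trans ?_ h), fun h => hw (List.IsInfix.trans ?_ h)⟩
  · exact ⟨[], List.replicate (s + 1) 1 ++ [0], by simp [leadX, List.replicate_succ]⟩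
  · exact ⟨[], List.replicate s 1 ++ [0, 0], by simp [leadY, List.replicate_succ]⟩

lemma two_pow_le_card_normalWords {r : ℕ} (hr : 1 ≤ r) (j : ℕ) :
    2 ^ j ≤ (normalWords r (2 * j)).card := by
  classical
  -- An `x` inserted after every letter prevents `yy`.
  set f : List (Fin 2) → List (Fin 2) := fun w => w.flatMap fun a => [a, 0] with hf
  have hinj : Function.Injective f := by
    intro u v h
    induction u generalizing v with
    | nil => rcases v with _ | ⟨b, v⟩ <;> simp [hf] at h ⊢
    | cons a u ih =>
      rcases v with _ | ⟨b, v⟩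
      · simp [hf] at h
      · simp only [hf, List.flatMap_cons, List.cons_append, List.nil_append, List.cons.injEq,
          true_and] at h
        rw [h.1, ih h.2]
  have hno : ∀ w, ¬ [1, 1] <:+: f w := by
    intro w
    induction w with
    | nil => simp [hf]
    | cons a w ih =>
      have : f (a :: w) = a :: 0 :: f w := by simp [hf]
      rw [this, List.infix_cons_iff, List.infix_cons_iff]
      simp [ih]
  have h : (words j).image f ⊆ normalWords r (2 * j) := by
    intro w hw
    obtain ⟨u, hu, rfl⟩ := Finset.mem_image.1 hw
    rw [mem_words] at hu
    rw [mem_normalWords]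
    exact ⟨by simp [hf, List.length_flatMap, hu, mul_comm], normal_of_not_infix hr (hno u)⟩
  have := Finset.card_le_card h
  rwa [Finset.card_image_of_injective _ hinj, card_words] at this

end Count

/-! ### Growth -/

lemma IsAtLeastQuadratic.not_isLinearlyBounded {f : ℕ → ℕ} (hf : IsAtLeastQuadratic f) :
    ¬ IsLinearlyBounded f := by
  obtain ⟨c, hc, h⟩ := hf
  rintro ⟨C, hC⟩
  obtain ⟨k, hk⟩ := exists_nat_gt (2 * |C| / c)
  have h1 := (h (k + 1)).trans (hC (k + 1))
  rw [div_lt_iff₀ hc] at hk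
  push_cast at h1
  have hk0 : (0 : ℝ) ≤ k := k.cast_nonneg
  have h2 : C * ((k : ℝ) + 1 + 1) ≤ |C| * (2 * (k + 1)) :=
    mul_le_mul (le_abs_self C) (by linarith) (by positivity) (abs_nonneg C)
  have h3 : c * ((k : ℝ) + 1) ≤ 2 * |C| := by
    have : (c * ((k : ℝ) + 1)) * (k + 1) ≤ (2 * |C|) * (k + 1) := by linarith
    exact le_of_mul_le_mul_right this (by positivity)
  linarith

lemma IsAtLeastQuadratic.mono {f g : ℕ → ℕ} (hf : IsAtLeastQuadratic f) (h : ∀ k, f k ≤ g k) :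
    IsAtLeastQuadratic g := by
  obtain ⟨c, hc, hq⟩ := hf
  exact ⟨c, hc, fun k => (hq k).trans (by exact_mod_cast h k)⟩

variable {K : Type*} [Field K]

lemma isAtLeastQuadratic_hilbertFn {F : FreeAlgebra K (Fin 2)} (hF : IsHomogeneousPotential 4 F) :
    IsAtLeastQuadratic (hilbertFn F) := by
  -- The constant comes from squaring `k ≤ 4 (k / 4 + 1)`.
  refine ⟨1 / 16, by norm_num, fun k => ?_⟩
  have h : (k / 4 + 1) ^ 2 ≤ hilbertFn F k :=
    (sq_le_card_normalWords_zero k).trans (card_normalWords_le_hilbertFn (r := 0) hF k)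
  have h1 : k ≤ 4 * (k / 4 + 1) := by omega
  have h2 : k ^ 2 ≤ 16 * hilbertFn F k := by
    calc k ^ 2 ≤ (4 * (k / 4 + 1)) ^ 2 := Nat.pow_le_pow_left h1 2
      _ = 16 * (k / 4 + 1) ^ 2 := by ring
      _ ≤ _ := Nat.mul_le_mul_left _ h
  have h3 : ((k : ℝ)) ^ 2 ≤ 16 * hilbertFn F k := by exact_mod_cast h2
  linarith

lemma growthFn_le_two_pow (F : FreeAlgebra K (Fin 2)) (k : ℕ) : growthFn F k ≤ 2 ^ (k + 1) := by
  classical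
  let S := (Finset.range (k + 1)).biUnion words
  have hS : filteredPart K k = (wordSpan K (S : Set (List (Fin 2)))).map
      (wordEquiv K).toLinearMap := by
    rw [map_wordEquiv_wordSpan, filteredPart]
    congr 2
    ext w
    simp [S, FreeMonoid.length]
  have : FiniteDimensional K (filteredPart K k) := by rw [hS]; infer_instance
  calc growthFn F k ≤ Module.finrank K (filteredPart K k) := Submodule.finrank_map_le _ _
    _ ≤ Module.finrank K (wordSpan K (S : Set (List (Fin 2)))) := by
        rw [hS]
        exact Submodule.finrank_map_le _ _
    _ = S.card := finrank_wordSpan S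
    _ ≤ ∑ j ∈ Finset.range (k + 1), (words j).card := Finset.card_biUnion_le
    _ = ∑ j ∈ Finset.range (k + 1), 2 ^ j := by simp only [card_words]
    _ ≤ 2 ^ (k + 1) := (Nat.geomSum_lt le_rfl fun j hj => by simpa using hj).le

lemma isExponential_growthFn {n : ℕ} (hn : 5 ≤ n) {F : FreeAlgebra K (Fin 2)}
    (hF : IsHomogeneousPotential n F) : IsExponential (growthFn F) := by
  obtain ⟨r, rfl⟩ := Nat.exists_eq_add_of_le' (show 4 ≤ n by omega)
  -- The lower bound is `2^(k / 2)`, where the factor `1 / 2` covers odd `k`; the upper bound is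
  -- `2^(k + 1)`, exceeding the number of words of length at most `k`.
  refine ⟨1 / 2, √2, 2, 2, by norm_num, Real.one_lt_sqrt_two, fun k => ⟨?_, ?_⟩⟩
  · have h1 : 2 ^ (k / 2) ≤ growthFn F k :=
      (two_pow_le_card_normalWords (by omega) (k / 2)).trans
        ((card_normalWords_le_hilbertFn hF _).trans (hilbertFn_le_growthFn F (by omega)))
    have h2 : (2 : ℝ) ^ (k / 2) ≤ growthFn F k := by exact_mod_cast h1
    have h3 : (√2 : ℝ) ^ k ≤ 2 * 2 ^ (k / 2) := by
      conv_lhs => rw [← Nat.div_add_mod k 2]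
      rw [pow_add, pow_mul, Real.sq_sqrt (by norm_num), mul_comm]
      refine mul_le_mul_of_nonneg_right ?_ (by positivity)
      rcases Nat.mod_two_eq_zero_or_one k with h | h <;> rw [h]
      · norm_num
      · simp
    linarith
  · have h := growthFn_le_two_pow F k
    have h' : (growthFn F k : ℝ) ≤ 2 ^ (k + 1) := by exact_mod_cast h
    rwa [pow_succ'] at h'

lemma isPolynomiallyBounded_growthFn_modelPotential :
    IsPolynomiallyBounded (growthFn (modelPotential K 4)) := by
  refine ⟨1, 3, fun k => ?_⟩
  have h : growthFn (modelPotential K 4) k ≤ (k + 1) ^ 3 :=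
    calc growthFn (modelPotential K 4) k
        ≤ ∑ j ∈ Finset.range (k + 1), (normalWords 0 j).card := growthFn_modelPotential_le 0 k
      _ ≤ ∑ j ∈ Finset.range (k + 1), (k + 1) ^ 2 := by
          refine Finset.sum_le_sum fun j hj => (card_normalWords_zero_le j).trans ?_
          rw [Finset.mem_range] at hj
          exact Nat.pow_le_pow_left hj 2
      _ = (k + 1) ^ 3 := by
          rw [Finset.sum_const, Finset.card_range, smul_eq_mul]
          ring
  rw [one_mul]
  exact_mod_cast h

end PotentialAlgebra

theorem mainTheorem3 (K : Type*) [Field K] :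
    (∃ F : FreeAlgebra K (Fin 2), PotentialAlgebra.IsHomogeneousPotential 4 F ∧
      PotentialAlgebra.IsPolynomiallyBounded (PotentialAlgebra.growthFn F)) ∧
    (∀ F : FreeAlgebra K (Fin 2), PotentialAlgebra.IsHomogeneousPotential 4 F →
      PotentialAlgebra.IsAtLeastQuadratic (PotentialAlgebra.hilbertFn F) ∧
      PotentialAlgebra.IsAtLeastQuadratic (PotentialAlgebra.growthFn F) ∧
      ¬ PotentialAlgebra.IsLinearlyBounded (PotentialAlgebra.hilbertFn F) ∧
      ¬ PotentialAlgebra.IsLinearlyBounded (PotentialAlgebra.growthFn F)) ∧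
    (∀ n : ℕ, 5 ≤ n → ∀ F : FreeAlgebra K (Fin 2),
      PotentialAlgebra.IsHomogeneousPotential n F →
      PotentialAlgebra.IsExponential (PotentialAlgebra.growthFn F)) := by
  refine ⟨⟨PotentialAlgebra.modelPotential K 4,
    PotentialAlgebra.modelPotential_isHomogeneousPotential 4,
    PotentialAlgebra.isPolynomiallyBounded_growthFn_modelPotential⟩, fun F hF => ?_,
    fun n hn F hF => PotentialAlgebra.isExponential_growthFn hn hF⟩
  have h1 := PotentialAlgebra.isAtLeastQuadratic_hilbertFn hF
  have h2 := h1.mono fun k => PotentialAlgebra.hilbertFn_le_growthFn F le_rfl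
  exact ⟨h1, h2, h1.not_isLinearlyBounded, h2.not_isLinearlyBounded⟩
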